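/- Let $n\ge 1$ and let $\Omega\subset\mathbb{R}^n$ be a bounded open set. Let $H^1(\Omega)$ be the Hilbert space of the real functions $f\in L^2(\Omega)$ whose distributional gradient $\nabla f$ is in $L^2(\Omega)^n$, with $\|f\|_{H^1}^2=\|f\|_{L^2}^2+\|\nabla f\|_{L^2}^2$; let $H^1_0(\Omega)$ be the closure of $C_c^\infty(\Omega)$ in $H^1(\Omega)$, equipped with the norm $\|\psi\|_{H^1_0}=\|\nabla\psi\|_{L^2}$; and let $H^{-1}(\Omega)=H^1_0(\Omega)'$ be the space of continuous linear forms on $H^1_0(\Omega)$ with the dual norm. Theorem (Rellich). The canonical injection $$T: L^2(\Omega)\to H^{-1}(\Omega),\qquad \langle Tv,\psi\rangle=\int_\Omega v\,\psi\,dx\quad\text{for all }v\in L^2(\Omega),\ \psi\in H^1_0(\Omega),$$ is a well-defined, injective, continuous linear map, and it is compact (the image of the unit ball of $L^2(\Omega)$ has compact closure in $H^{-1}(\Omega)$). -/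

import Mathlib

open MeasureTheory TopologicalSpace
open scoped Distributions

noncomputable section

namespace Rellich

/-- `ℝⁿ` with its Euclidean structure. -/
abbrev Rn (n : ℕ) : Type := EuclideanSpace ℝ (Fin n)

/-- The real Hilbert space `L²(Ω)`, for Lebesgue measure on `Ω`. -/
abbrev L2 {n : ℕ} (Ω : Opens (Rn n)) : Type :=
  Lp ℝ 2 ((volume : Measure (Rn n)).restrict (Ω : Set (Rn n)))

/-- The Hilbert space `L²(Ω)ⁿ`, with `‖p‖² = ∑ i, ‖p i‖²`. -/
abbrev L2Vec {n : ℕ} (Ω : Opens (Rn n)) : Type := PiLp 2 (fun _ : Fin n => L2 Ω)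

/-- The classical partial derivative `∂φ/∂xᵢ`. -/
def partialDeriv {n : ℕ} (i : Fin n) (φ : Rn n → ℝ) (x : Rn n) : ℝ :=
  fderiv ℝ φ x (EuclideanSpace.single i 1)

/-- `p ∈ L²(Ω)ⁿ` is the gradient of `f ∈ L²(Ω)` in the sense of distributions:
`∫_Ω f ∂ᵢφ = - ∫_Ω pᵢ φ` for all `φ ∈ C_c^∞(Ω)` and all `i`. -/
def IsWeakGrad {n : ℕ} (Ω : Opens (Rn n)) (f : L2 Ω) (p : L2Vec Ω) : Prop :=
  ∀ (φ : 𝓓(Ω, ℝ)) (i : Fin n),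
    ∫ x in (Ω : Set (Rn n)), f x * partialDeriv i φ x =
      -∫ x in (Ω : Set (Rn n)), p i x * φ x

section helpers

variable {n : ℕ} {Ω : Opens (Rn n)}

theorem integrable_mul_test (f : L2 Ω) (φ : 𝓓(Ω, ℝ)) :
    Integrable (fun x => f x * φ x) (volume.restrict (Ω : Set (Rn n))) := by
  have h : MemLp (φ : Rn n → ℝ) 2 (volume.restrict (Ω : Set (Rn n))) :=
    (φ.continuous.memLp_of_hasCompactSupport φ.hasCompactSupport).restrict _
  exact (Lp.memLp f).integrable_mul h

theorem integrable_mul_partialDeriv (f : L2 Ω) (φ : 𝓓(Ω, ℝ)) (i : Fin n) :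
    Integrable (fun x => f x * partialDeriv i φ x) (volume.restrict (Ω : Set (Rn n))) := by
  have hc : Continuous (partialDeriv i (φ : Rn n → ℝ)) := by
    have := φ.contDiff.continuous_fderiv (by simp)
    unfold partialDeriv
    fun_prop
  have hs : HasCompactSupport (partialDeriv i (φ : Rn n → ℝ)) :=
    φ.hasCompactSupport.fderiv_apply ℝ _
  have h : MemLp (partialDeriv i (φ : Rn n → ℝ)) 2 (volume.restrict (Ω : Set (Rn n))) :=
    (hc.memLp_of_hasCompactSupport hs).restrict _
  exact (Lp.memLp f).integrable_mul h

theorem IsWeakGrad.add {f g : L2 Ω} {p q : L2Vec Ω} (hf : IsWeakGrad Ω f p)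
    (hg : IsWeakGrad Ω g q) : IsWeakGrad Ω (f + g) (p + q) := by
  intro φ i
  have h1 : (fun x => (f + g : L2 Ω) x * partialDeriv i φ x)
      =ᵐ[volume.restrict (Ω : Set (Rn n))]
        fun x => f x * partialDeriv i φ x + g x * partialDeriv i φ x := by
    filter_upwards [Lp.coeFn_add f g] with x hx
    rw [hx, Pi.add_apply, add_mul]
  have h2 : (fun x => (p + q) i x * φ x) =ᵐ[volume.restrict (Ω : Set (Rn n))]
      fun x => p i x * φ x + q i x * φ x := by
    filter_upwards [Lp.coeFn_add (p i) (q i)] with x hx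
    rw [PiLp.add_apply, hx, Pi.add_apply, add_mul]
  rw [integral_congr_ae h1, integral_congr_ae h2,
    integral_add (integrable_mul_partialDeriv f φ i) (integrable_mul_partialDeriv g φ i),
    integral_add (integrable_mul_test (p i) φ) (integrable_mul_test (q i) φ), hf φ i, hg φ i]
  ring

theorem IsWeakGrad.smul (c : ℝ) {f : L2 Ω} {p : L2Vec Ω} (hf : IsWeakGrad Ω f p) :
    IsWeakGrad Ω (c • f) (c • p) := by
  intro φ i
  have h1 : (fun x => (c • f : L2 Ω) x * partialDeriv i φ x)
      =ᵐ[volume.restrict (Ω : Set (Rn n))] fun x => c * (f x * partialDeriv i φ x) := by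
    filter_upwards [Lp.coeFn_smul c f] with x hx
    rw [hx, Pi.smul_apply, smul_eq_mul, mul_assoc]
  have h2 : (fun x => (c • p) i x * φ x) =ᵐ[volume.restrict (Ω : Set (Rn n))]
      fun x => c * (p i x * φ x) := by
    filter_upwards [Lp.coeFn_smul c (p i)] with x hx
    rw [PiLp.smul_apply, hx, Pi.smul_apply, smul_eq_mul, mul_assoc]
  rw [integral_congr_ae h1, integral_congr_ae h2, integral_const_mul, integral_const_mul, hf φ i]
  ring

theorem IsWeakGrad.zero : IsWeakGrad Ω (0 : L2 Ω) (0 : L2Vec Ω) := by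
  intro φ i
  have h1 : (fun x => (0 : L2 Ω) x * partialDeriv i φ x)
      =ᵐ[volume.restrict (Ω : Set (Rn n))] fun _ => 0 := by
    filter_upwards [Lp.coeFn_zero ℝ 2 (volume.restrict (Ω : Set (Rn n)))] with x hx
    rw [hx, Pi.zero_apply, zero_mul]
  have h2 : (fun x => (0 : L2Vec Ω) i x * φ x) =ᵐ[volume.restrict (Ω : Set (Rn n))]
      fun _ => 0 := by
    filter_upwards [Lp.coeFn_zero ℝ 2 (volume.restrict (Ω : Set (Rn n)))] with x hx
    rw [PiLp.zero_apply, hx, Pi.zero_apply, zero_mul]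
  rw [integral_congr_ae h1, integral_congr_ae h2]
  simp

end helpers

/-- `H¹(Ω) = {f ∈ L²(Ω) : ∇f ∈ L²(Ω)ⁿ}`. An element is stored as the pair `(f, ∇f)`, in which
`f` determines `∇f` (see `H1.ext`); thus the norm inherited from the product is the `H¹` norm,
`‖f‖² = ‖f‖²_{L²} + ‖∇f‖²_{L²}`. -/
def H1 {n : ℕ} (Ω : Opens (Rn n)) : Submodule ℝ (WithLp 2 (L2 Ω × L2Vec Ω)) where
  carrier := {w | IsWeakGrad Ω w.fst w.snd}
  add_mem' ha hb := IsWeakGrad.add ha hb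
  zero_mem' := IsWeakGrad.zero
  smul_mem' c _ h := IsWeakGrad.smul c h

/-- An element of `H¹(Ω)` is determined by its underlying function in `L²(Ω)`. -/
theorem H1.ext {n : ℕ} {Ω : Opens (Rn n)} {v w : H1 Ω} (h : v.1.fst = w.1.fst) : v = w := by
  have key : ∀ i, v.1.snd i = w.1.snd i := by
    intro i
    have hi : ∀ u : L2 Ω, LocallyIntegrableOn (fun x => u x) (Ω : Set (Rn n)) volume := fun u =>
      (locallyIntegrableOn_of_locallyIntegrable_restrict
        ((Lp.memLp u).locallyIntegrable (by norm_num)))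
    have hz := Ω.isOpen.ae_eq_zero_of_integral_contDiff_smul_eq_zero
      ((hi (v.1.snd i)).sub (hi (w.1.snd i))) (fun g hg hgc hgs => by
        let φ : 𝓓(Ω, ℝ) := ⟨g, hg, hgc, hgs⟩
        have e : ∫ x in (Ω : Set (Rn n)), v.1.snd i x * φ x =
            ∫ x in (Ω : Set (Rn n)), w.1.snd i x * φ x := by
          have e1 := v.2 φ i
          have e2 := w.2 φ i
          rw [h] at e1
          linarith
        have e' : ∫ x in (Ω : Set (Rn n)), (v.1.snd i x * φ x - w.1.snd i x * φ x) = 0 := by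
          rw [integral_sub (integrable_mul_test _ φ) (integrable_mul_test _ φ), e, sub_self]
        rw [← setIntegral_eq_integral_of_forall_compl_eq_zero (s := (Ω : Set (Rn n)))
          (fun x hx => by
            have : g x = 0 := by
              by_contra hne
              exact hx (hgs (subset_tsupport _ hne))
            rw [this, zero_smul]), ← e']
        refine integral_congr_ae (Filter.Eventually.of_forall fun x => ?_)
        change g x * (_ - _) = _ * g x - _ * g x
        ring)
    refine Lp.ext ?_
    rw [Filter.EventuallyEq, ae_restrict_iff' Ω.isOpen.measurableSet]
    filter_upwards [hz] with x hx hxΩ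
    exact sub_eq_zero.1 (hx hxΩ)
  exact Subtype.ext ((WithLp.ofLp_injective 2) (Prod.ext h (PiLp.ext key)))

/-- `C_c^∞(Ω)`, as a subspace of `H¹(Ω)`. -/
def testH1 {n : ℕ} (Ω : Opens (Rn n)) : Submodule ℝ (H1 Ω) where
  carrier := {w | ∃ φ : 𝓓(Ω, ℝ), w.1.fst =ᵐ[volume.restrict (Ω : Set (Rn n))] φ}
  add_mem' := by
    rintro a b ⟨φ, hφ⟩ ⟨ψ, hψ⟩
    refine ⟨φ + ψ, ?_⟩
    filter_upwards [Lp.coeFn_add a.1.fst b.1.fst, hφ, hψ] with x hx h1 h2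
    change (a.1.fst + b.1.fst : L2 Ω) x = φ x + ψ x
    rw [hx, Pi.add_apply, h1, h2]
  zero_mem' := ⟨0, Lp.coeFn_zero ℝ 2 (volume.restrict (Ω : Set (Rn n)))⟩
  smul_mem' := by
    rintro c a ⟨φ, hφ⟩
    refine ⟨c • φ, ?_⟩
    filter_upwards [Lp.coeFn_smul c a.1.fst, hφ] with x hx h1
    change (c • a.1.fst : L2 Ω) x = c • φ x
    rw [hx, Pi.smul_apply, h1]

/-- The space `H¹₀(Ω)`, the closure of `C_c^∞(Ω)` in `H¹(Ω)`. It is a type of its own, because it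
does not carry the `H¹` norm but the norm `‖ψ‖ = ‖∇ψ‖_{L²}`. -/
def H10 {n : ℕ} (Ω : Opens (Rn n)) : Type := (testH1 Ω).topologicalClosure

namespace H10

variable {n : ℕ} {Ω : Opens (Rn n)}

instance : AddCommGroup (H10 Ω) :=
  inferInstanceAs (AddCommGroup (testH1 Ω).topologicalClosure)

instance : Module ℝ (H10 Ω) :=
  inferInstanceAs (Module ℝ (testH1 Ω).topologicalClosure)

/-- The function in `L²(Ω)` underlying an element of `H¹₀(Ω)`. -/
def toL2 : H10 Ω →ₗ[ℝ] L2 Ω where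
  toFun ψ := ψ.1.1.fst
  map_add' _ _ := rfl
  map_smul' _ _ := rfl

/-- The gradient `∇ : H¹₀(Ω) → L²(Ω)ⁿ`. -/
def grad : H10 Ω →ₗ[ℝ] L2Vec Ω where
  toFun ψ := ψ.1.1.snd
  map_add' _ _ := rfl
  map_smul' _ _ := rfl

/-- `‖ψ‖ = ‖∇ψ‖_{L²}`. (On an arbitrary open set this is a seminorm, on a bounded one a norm.) -/
instance : SeminormedAddCommGroup (H10 Ω) :=
  SeminormedAddCommGroup.induced (H10 Ω) (L2Vec Ω) grad

instance : NormedSpace ℝ (H10 Ω) := NormedSpace.induced ℝ (H10 Ω) (L2Vec Ω) grad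

end H10

/-- `H⁻¹(Ω)`, the space of continuous linear forms on `H¹₀(Ω)`, with the dual norm
`‖ℓ‖ = sup {|ℓ ψ| / ‖ψ‖}`. -/
abbrev Hminus1 {n : ℕ} (Ω : Opens (Rn n)) : Type := StrongDual ℝ (H10 Ω)

end Rellich

end

noncomputable section

namespace Rellich

/-! ### Translation estimates in L². -/

section translation

/-! `T` is the transpose of the embedding `J : H¹₀(Ω) → L²(Ω)`. If finite-dimensional `V` satisfy
`‖Jψ - P_V Jψ‖ ≤ δ‖ψ‖`, then `‖T - T P_V‖ ≤ δ`, so `T` is a norm limit of finite-rank operators,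
hence compact (`isCompactOperator_of_transpose`).

Everything else rests on `‖φ(· + h) - φ‖ ≤ |h| ‖∇φ‖` for test functions. Taking `h` longer than the
diameter of `Ω` gives Poincaré's inequality, hence the continuity of `T`. Small `h` gives `V`: the
functions constant on the cells of a finite partition of `Ω`, each cell lying within `ε` of a node.
Sampling `φ` at the nodes need not approximate it in L², but sampling at the nodes shifted by a
common `t` does for some `t`, by averaging over `|t| < ε`
(`exists_lintegral_enorm_comp_add_sub_sq_le`). The shift changes only the cell values, so `V` does
not depend on `φ`. Density extends both estimates to `H¹₀(Ω)`. -/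

theorem sq_lintegral_le_lintegral_sq {α : Type*} [MeasurableSpace α] (μ : Measure α)
    [IsProbabilityMeasure μ] {f : α → ENNReal} (hf : AEMeasurable f μ) :
    (∫⁻ x, f x ∂μ) ^ 2 ≤ ∫⁻ x, f x ^ 2 ∂μ := by
  have h := ENNReal.lintegral_mul_le_Lp_mul_Lq μ (Real.HolderConjugate.two_two) hf
    (aemeasurable_const (b := (1 : ENNReal)))
  simp only [Pi.mul_apply, mul_one, lintegral_const, measure_univ, ENNReal.rpow_two,
    one_pow, ENNReal.one_rpow] at h
  calc (∫⁻ x, f x ∂μ) ^ 2 ≤ ((∫⁻ x, f x ^ 2 ∂μ) ^ (1 / 2 : ℝ)) ^ 2 := by gcongr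
    _ = ∫⁻ x, f x ^ 2 ∂μ := by
      rw [← ENNReal.rpow_natCast, ← ENNReal.rpow_mul]
      norm_num

variable {E : Type*} [NormedAddCommGroup E] [NormedSpace ℝ E]

/-- The increment of a `C¹` function is controlled by its derivative along the segment. -/
theorem enorm_sub_sq_le_lintegral_fderiv {f : E → ℝ} (hf : ContDiff ℝ 1 f) (x h : E) :
    ‖f (x + h) - f x‖ₑ ^ 2 ≤
      ∫⁻ t in Set.Ioc (0 : ℝ) 1, ‖fderiv ℝ f (x + t • h) h‖ₑ ^ 2 := by
  have hc : Continuous fun t : ℝ => fderiv ℝ f (x + t • h) h := by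
    have := hf.continuous_fderiv (by simp)
    fun_prop
  have hd : ∀ t : ℝ, HasDerivAt (fun t : ℝ => f (x + t • h)) (fderiv ℝ f (x + t • h) h) t := by
    intro t
    have h1 : HasDerivAt (fun t : ℝ => x + t • h) h t := by
      simpa using ((hasDerivAt_id t).smul_const h).const_add x
    exact ((hf.differentiable (by simp) _).hasFDerivAt).comp_hasDerivAt t h1
  have e : f (x + h) - f x = ∫ t in Set.Ioc (0 : ℝ) 1, fderiv ℝ f (x + t • h) h := by
    rw [← intervalIntegral.integral_of_le zero_le_one,
      intervalIntegral.integral_eq_sub_of_hasDerivAt (fun t _ => hd t) (hc.intervalIntegrable 0 1)]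
    simp
  have : IsProbabilityMeasure (volume.restrict (Set.Ioc (0 : ℝ) 1)) := ⟨by simp⟩
  rw [e]
  calc _ ≤ (∫⁻ t in Set.Ioc (0 : ℝ) 1, ‖fderiv ℝ f (x + t • h) h‖ₑ) ^ 2 := by
        gcongr
        exact enorm_integral_le_lintegral_enorm _
    _ ≤ _ := sq_lintegral_le_lintegral_sq _ hc.enorm.measurable.aemeasurable

variable [MeasurableSpace E] [BorelSpace E]

/-- Integrate the bound along segments and exchange integrals: by translation invariance the inner
integral does not depend on `t`. -/
theorem lintegral_enorm_translate_sub_sq_le [SecondCountableTopology E] (μ : Measure E) [SFinite μ]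
    [μ.IsAddRightInvariant] {f : E → ℝ} (hf : ContDiff ℝ 1 f) (h : E) :
    ∫⁻ x, ‖f (x + h) - f x‖ₑ ^ 2 ∂μ ≤ ∫⁻ x, ‖fderiv ℝ f x h‖ₑ ^ 2 ∂μ := by
  have hc := hf.continuous_fderiv (by simp)
  have hm : Continuous fun p : E × ℝ => ‖fderiv ℝ f (p.1 + p.2 • h) h‖ₑ := by fun_prop
  calc _ ≤ ∫⁻ x, (∫⁻ t in Set.Ioc (0 : ℝ) 1, ‖fderiv ℝ f (x + t • h) h‖ₑ ^ 2) ∂μ :=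
        lintegral_mono fun x => enorm_sub_sq_le_lintegral_fderiv hf x h
    _ = ∫⁻ t in Set.Ioc (0 : ℝ) 1, (∫⁻ x, ‖fderiv ℝ f (x + t • h) h‖ₑ ^ 2 ∂μ) :=
        lintegral_lintegral_swap (hm.measurable.pow_const 2).aemeasurable
    _ = ∫⁻ _ in Set.Ioc (0 : ℝ) 1, (∫⁻ x, ‖fderiv ℝ f x h‖ₑ ^ 2 ∂μ) := by
        congr 1; ext t
        exact lintegral_add_right_eq_self (μ := μ) (fun x => ‖fderiv ℝ f x h‖ₑ ^ 2) (t • h)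
    _ = _ := by simp

/-- If the translates of `f` are close to `f`, then `f` is close to one of the functions
`x ↦ f (g x + t)`, for any `g` close to the identity. -/
theorem exists_lintegral_enorm_comp_add_sub_sq_le [FiniteDimensional ℝ E] [Nontrivial E]
    (μ : Measure E) [μ.IsAddHaarMeasure] {f : E → ℝ} (hf : Continuous f) {D : ENNReal}
    (hD : ∀ h, ∫⁻ x, ‖f (x + h) - f x‖ₑ ^ 2 ∂μ ≤ ‖h‖ₑ ^ 2 * D)
    {g : E → E} (hg : Measurable g) {S : Set E} (hS : MeasurableSet S) {ε : ℝ} (hε : 0 < ε)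
    (hgS : ∀ x ∈ S, ‖g x - x‖ ≤ ε) :
    ∃ t, ∫⁻ x in S, ‖f (g x + t) - f x‖ₑ ^ 2 ∂μ ≤
      ENNReal.ofReal (2 ^ Module.finrank ℝ E) * (ENNReal.ofReal (2 * ε) ^ 2 * D) := by
  have hb0 : μ (Metric.ball 0 ε) ≠ 0 := (Metric.measure_ball_pos μ 0 hε).ne'
  have hbt : μ (Metric.ball 0 ε) ≠ ⊤ := measure_ball_lt_top.ne
  have hfm := hf.measurable
  have hF : Measurable fun p : E × E => ‖f (g p.1 + p.2) - f p.1‖ₑ ^ 2 := by fun_prop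
  -- Some `t` in the ball does at least as well as the average over the ball.
  obtain ⟨t, -, ht⟩ := exists_le_setLAverage (μ := μ) (s := Metric.ball 0 ε)
    (f := fun t => ∫⁻ x in S, ‖f (g x + t) - f x‖ₑ ^ 2 ∂μ) hb0
    hbt (hF.comp measurable_swap).lintegral_prod_right'.aemeasurable
  refine ⟨t, ht.trans ?_⟩
  rw [setLAverage_eq]
  refine ENNReal.div_le_of_le_mul ?_
  have hG : Measurable fun p : E × E => ‖f (p.1 + p.2) - f p.1‖ₑ ^ 2 := by fun_prop
  calc ∫⁻ t in Metric.ball 0 ε, ∫⁻ x in S, ‖f (g x + t) - f x‖ₑ ^ 2 ∂μ ∂μ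
      = ∫⁻ x in S, ∫⁻ t in Metric.ball 0 ε, ‖f (g x + t) - f x‖ₑ ^ 2 ∂μ ∂μ :=
        (lintegral_lintegral_swap hF.aemeasurable).symm
    _ ≤ ∫⁻ x in S, ∫⁻ h in Metric.ball 0 (2 * ε), ‖f (x + h) - f x‖ₑ ^ 2 ∂μ ∂μ := by
        refine setLIntegral_mono' hS fun x hx => ?_
        -- Substituting `h = t + (g x - x)` turns `f (g x + t)` into `f (x + h)`; as `|g x - x| ≤
        -- ε`, the `ε`-ball lands in the `2ε`-ball.
        rw [← lintegral_indicator measurableSet_ball, ← lintegral_indicator measurableSet_ball,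
          ← lintegral_add_right_eq_self (μ := μ) ((Metric.ball 0 (2 * ε)).indicator _) (g x - x)]
        refine lintegral_mono fun t => ?_
        by_cases h : t ∈ Metric.ball 0 ε
        · have h' : t + (g x - x) ∈ Metric.ball 0 (2 * ε) := by
            rw [mem_ball_zero_iff] at h ⊢
            have := norm_add_le t (g x - x)
            have := hgS x hx
            linarith
          rw [Set.indicator_of_mem h, Set.indicator_of_mem h']
          simp [add_comm t, ← add_assoc]
        · rw [Set.indicator_of_notMem h]
          exact zero_le
    _ ≤ ∫⁻ x, ∫⁻ h in Metric.ball 0 (2 * ε), ‖f (x + h) - f x‖ₑ ^ 2 ∂μ ∂μ :=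
        setLIntegral_le_lintegral _ _
    _ = ∫⁻ h in Metric.ball 0 (2 * ε), ∫⁻ x, ‖f (x + h) - f x‖ₑ ^ 2 ∂μ ∂μ :=
        lintegral_lintegral_swap hG.aemeasurable
    _ ≤ ∫⁻ h in Metric.ball 0 (2 * ε), ENNReal.ofReal (2 * ε) ^ 2 * D ∂μ := by
        refine setLIntegral_mono' measurableSet_ball fun h hh => (hD h).trans ?_
        gcongr
        rw [← ofReal_norm]
        exact ENNReal.ofReal_le_ofReal (mem_ball_zero_iff.1 hh).le
    _ = _ := by
        -- The factor `2 ^ finrank` is the volume ratio of the two balls.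
        rw [setLIntegral_const, Measure.addHaar_ball_mul μ 0 zero_le_two]
        ring

end translation

/-! ### Dirichlet energy and Poincaré's inequality for test functions. -/

section testFunctions

variable {n : ℕ} {Ω : Opens (Rn n)}

theorem partialDeriv_continuous {φ : Rn n → ℝ} (hφ : ContDiff ℝ 1 φ) (i : Fin n) :
    Continuous (partialDeriv i φ) := by
  have := hφ.continuous_fderiv (by simp)
  unfold partialDeriv
  fun_prop

theorem partialDeriv_eq_zero_of_notMem (φ : 𝓓(Ω, ℝ)) (i : Fin n) {x : Rn n} (hx : x ∉ Ω) :
    partialDeriv i φ x = 0 := by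
  have : fderiv ℝ φ x = 0 := by
    by_contra h
    exact hx (φ.tsupport_subset (tsupport_fderiv_subset ℝ (subset_tsupport _ h)))
  simp [partialDeriv, this]

theorem test_eq_zero_of_notMem (φ : 𝓓(Ω, ℝ)) {x : Rn n} (hx : x ∉ Ω) : φ x = 0 := by
  by_contra h
  exact hx (φ.tsupport_subset (subset_tsupport _ h))

theorem enorm_fderiv_apply_sq_le (φ : Rn n → ℝ) (x h : Rn n) :
    ‖fderiv ℝ φ x h‖ₑ ^ 2 ≤ ‖h‖ₑ ^ 2 * ∑ i, ‖partialDeriv i φ x‖ₑ ^ 2 := by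
  have e : fderiv ℝ φ x h = ∑ i, h i * partialDeriv i φ x := by
    conv_lhs => rw [← (EuclideanSpace.basisFun (Fin n) ℝ).sum_repr h]
    simp [partialDeriv]
  have key : (fderiv ℝ φ x h) ^ 2 ≤ ‖h‖ ^ 2 * ∑ i, partialDeriv i φ x ^ 2 := by
    rw [e, EuclideanSpace.real_norm_sq_eq]
    exact Finset.sum_mul_sq_le_sq_mul_sq _ _ _
  have hE : ∀ r : ℝ, ‖r‖ₑ ^ 2 = ENNReal.ofReal (r ^ 2) := fun r => by
    rw [← ofReal_norm, ← ENNReal.ofReal_pow (norm_nonneg _), Real.norm_eq_abs, sq_abs]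
  simp_rw [hE, ← ofReal_norm h]
  rw [← ENNReal.ofReal_pow (norm_nonneg _), ← ENNReal.ofReal_sum_of_nonneg (fun _ _ => sq_nonneg _),
    ← ENNReal.ofReal_mul (sq_nonneg _)]
  exact ENNReal.ofReal_le_ofReal key

/-- The Dirichlet energy `‖∇φ‖²_{L²}`. -/
def energy (Ω : Opens (Rn n)) (φ : Rn n → ℝ) : ENNReal :=
  ∑ i, ∫⁻ x in (Ω : Set (Rn n)), ‖partialDeriv i φ x‖ₑ ^ 2

theorem lintegral_translate_sub_test_sq_le (φ : 𝓓(Ω, ℝ)) (h : Rn n) :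
    ∫⁻ x, ‖φ (x + h) - φ x‖ₑ ^ 2 ≤ ‖h‖ₑ ^ 2 * energy Ω φ := by
  have hφ : ContDiff ℝ 1 (φ : Rn n → ℝ) := φ.contDiff.of_le (by simp)
  have hm : ∀ i, Measurable fun x => ‖partialDeriv i φ x‖ₑ ^ 2 := fun i =>
    (partialDeriv_continuous hφ i).enorm.measurable.pow_const 2
  calc _ ≤ ∫⁻ x, ‖fderiv ℝ φ x h‖ₑ ^ 2 := lintegral_enorm_translate_sub_sq_le volume hφ h
    _ ≤ ∫⁻ x, ‖h‖ₑ ^ 2 * ∑ i, ‖partialDeriv i φ x‖ₑ ^ 2 :=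
        lintegral_mono fun x => enorm_fderiv_apply_sq_le φ x h
    _ = ‖h‖ₑ ^ 2 * energy Ω φ := by
        rw [lintegral_const_mul _ (Finset.measurable_sum _ fun i _ => hm i),
          lintegral_finsetSum _ fun i _ => hm i, energy]
        congr 1
        refine Finset.sum_congr rfl fun i _ => (setLIntegral_eq_of_support_subset ?_).symm
        intro x hx
        by_contra hxΩ
        exact hx (by simp [partialDeriv_eq_zero_of_notMem φ i hxΩ])

/-- A translation of length `R` moves every point of `Ω` out of `Ω`, so on `Ω` the difference `φ(x +
h) - φ(x)` is just `-φ(x)`. -/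
theorem poincare_test [Nonempty (Fin n)] {R : ℝ} (hR : ∀ x ∈ Ω, ∀ y ∈ Ω, ‖x - y‖ < R)
    (hR0 : 0 ≤ R) (φ : 𝓓(Ω, ℝ)) :
    ∫⁻ x in (Ω : Set (Rn n)), ‖φ x‖ₑ ^ 2 ≤ ENNReal.ofReal R ^ 2 * energy Ω φ := by
  obtain ⟨i⟩ := ‹Nonempty (Fin n)›
  set h : Rn n := EuclideanSpace.single i R
  have hh : ‖h‖ = R := by simp [h, abs_of_nonneg hR0]
  calc ∫⁻ x in (Ω : Set (Rn n)), ‖φ x‖ₑ ^ 2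
      = ∫⁻ x in (Ω : Set (Rn n)), ‖φ (x + h) - φ x‖ₑ ^ 2 := by
        refine setLIntegral_congr_fun Ω.isOpen.measurableSet fun x hx => ?_
        have : x + h ∉ Ω := fun hxh => by
          have := hR _ hxh _ hx
          rw [add_sub_cancel_left, hh] at this
          exact this.false
        simp [test_eq_zero_of_notMem φ this]
    _ ≤ ∫⁻ x, ‖φ (x + h) - φ x‖ₑ ^ 2 := setLIntegral_le_lintegral _ _
    _ ≤ ‖h‖ₑ ^ 2 * energy Ω φ := lintegral_translate_sub_test_sq_le φ h
    _ = _ := by rw [← ofReal_norm h, hh]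

end testFunctions

/-! ### Finite-dimensional approximation and compactness of the transpose. -/

section compactness

theorem memLp_comp_of_finite {α ι : Type*} [MeasurableSpace α] (μ : Measure α) [IsFiniteMeasure μ]
    [Fintype ι] [MeasurableSpace ι] [MeasurableSingletonClass ι] {κ : α → ι} (hκ : Measurable κ)
    (c : ι → ℝ) : MemLp (fun x => c (κ x)) 2 μ :=
  MemLp.of_bound (((measurable_of_finite c).comp hκ).aestronglyMeasurable) ‖c‖
    (Filter.Eventually.of_forall fun _ => norm_le_pi_norm c _)

/-- Functions constant on the fibers of `κ`, as elements of `L²`. -/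
def fiberConstLp {α ι : Type*} [MeasurableSpace α] (μ : Measure α) [IsFiniteMeasure μ] [Fintype ι]
    [MeasurableSpace ι] [MeasurableSingletonClass ι] {κ : α → ι} (hκ : Measurable κ) :
    (ι → ℝ) →ₗ[ℝ] Lp ℝ 2 μ where
  toFun c := (memLp_comp_of_finite μ hκ c).toLp _
  map_add' _ _ := rfl
  map_smul' _ _ := rfl

theorem coeFn_fiberConstLp {α ι : Type*} [MeasurableSpace α] (μ : Measure α) [IsFiniteMeasure μ]
    [Fintype ι] [MeasurableSpace ι] [MeasurableSingletonClass ι] {κ : α → ι} (hκ : Measurable κ)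
    (c : ι → ℝ) : fiberConstLp μ hκ c =ᵐ[μ] fun x => c (κ x) :=
  (memLp_comp_of_finite μ hκ c).coeFn_toLp

theorem norm_sub_starProjection_le {L : Type*} [NormedAddCommGroup L] [InnerProductSpace ℝ L]
    (V : Submodule ℝ L) [V.HasOrthogonalProjection] (u : L) {w : L} (hw : w ∈ V) :
    ‖u - V.starProjection u‖ ≤ ‖u - w‖ := by
  rw [V.starProjection_minimal]
  exact ciInf_le ⟨0, by rintro _ ⟨_, rfl⟩; exact norm_nonneg _⟩ (⟨w, hw⟩ : V)

/-- Finitely many balls centred on a dense sequence cover the compact closure of `S`; `κ` picks the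
nearest centre of index at most `N`, hence `N + 1` labels. -/
theorem exists_measurable_fin_near {E : Type*} [NormedAddCommGroup E] [NormedSpace ℝ E]
    [FiniteDimensional ℝ E] [MeasurableSpace E] [BorelSpace E] {S : Set E}
    (hS : Bornology.IsBounded S) {ε : ℝ} (hε : 0 < ε) :
    ∃ (N : ℕ) (κ : E → Fin (N + 1)) (e : Fin (N + 1) → E), Measurable κ ∧
      ∀ x ∈ S, ‖e (κ x) - x‖ ≤ ε := by
  have hp : ProperSpace E := FiniteDimensional.proper ℝ E
  obtain ⟨s, hs⟩ := hS.isCompact_closure.elim_finite_subcover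
    (fun k : ℕ => Metric.ball (denseSeq E k) ε) (fun _ => Metric.isOpen_ball) (fun x _ => by
      obtain ⟨k, hk⟩ := (denseRange_denseSeq E).exists_dist_lt x hε
      exact Set.mem_iUnion.2 ⟨k, hk⟩)
  let N := s.sup id
  refine ⟨N, fun x => ⟨SimpleFunc.nearestPtInd (denseSeq E) N x,
    Nat.lt_succ_of_le (SimpleFunc.nearestPtInd_le _ _ _)⟩, fun k => denseSeq E k, ?_, ?_⟩
  · refine measurable_to_countable' fun k => ?_
    convert! (SimpleFunc.nearestPtInd (denseSeq E) N).measurableSet_fiber (k : ℕ) using 1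
    ext x
    simp [Fin.ext_iff]
  · intro x hx
    obtain ⟨k, hk, hxk⟩ := Set.mem_iUnion₂.1 (hs (subset_closure hx))
    have h1 := SimpleFunc.edist_nearestPt_le (denseSeq E) x (Finset.le_sup (f := id) hk)
    rw [edist_dist, edist_dist, ENNReal.ofReal_le_ofReal_iff dist_nonneg] at h1
    rw [← dist_eq_norm]
    rw [Metric.mem_ball, dist_comm] at hxk
    exact h1.trans hxk.le

/-- A form of Schauder's theorem: if `J` is approximated by its projections on finite-dimensional
subspaces, its transpose is compact. -/
theorem isCompactOperator_of_transpose {L H : Type*} [NormedAddCommGroup L] [InnerProductSpace ℝ L]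
    [SeminormedAddCommGroup H] [NormedSpace ℝ H] (J : H → L) (T : L →L[ℝ] StrongDual ℝ H)
    (hT : ∀ v ψ, T v ψ = inner ℝ v (J ψ))
    (hJ : ∀ δ : ℝ, 0 < δ → ∃ (V : Submodule ℝ L) (_ : FiniteDimensional ℝ V),
      ∀ ψ, ‖J ψ - V.starProjection (J ψ)‖ ≤ δ * ‖ψ‖) : IsCompactOperator T := by
  suffices h : T ∈ closure {f : L →L[ℝ] StrongDual ℝ H | IsCompactOperator f} from
    isClosed_setOfPred_isCompactOperator.closure_subset h
  refine (Metric.mem_closure_iff (α := L →L[ℝ] StrongDual ℝ H)).2 ?_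
  intro δ hδ
  obtain ⟨V, hV, h⟩ := hJ (δ / 2) (half_pos hδ)
  refine ⟨T ∘L V.starProjection, ?_, ?_⟩
  · have h1 : IsCompactOperator (T ∘L V.subtypeL) :=
      isCompactOperator_of_locallyCompactSpace_rng _
    exact h1.comp_clm V.orthogonalProjectionOnto
  · refine (dist_eq_norm T _).trans_lt (lt_of_le_of_lt ?_ (half_lt_self hδ))
    refine ContinuousLinearMap.opNorm_le_bound _ (half_pos hδ).le fun v => ?_
    refine ContinuousLinearMap.opNorm_le_bound _ (by positivity) fun ψ => ?_
    -- Self-adjointness moves the projection from `v` onto `J ψ`.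
    have e : (T - T ∘L V.starProjection) v ψ = inner ℝ v (J ψ - V.starProjection (J ψ)) := by
      simp [hT, inner_sub_right, V.inner_starProjection_left_eq_right]
    rw [e]
    calc _ ≤ ‖v‖ * ‖J ψ - V.starProjection (J ψ)‖ := norm_inner_le_norm _ _
      _ ≤ ‖v‖ * (δ / 2 * ‖ψ‖) := by gcongr; exact h ψ
      _ = _ := by ring

end compactness

/-! ### Passage from test functions to `H¹₀(Ω)`. -/

section Sobolev

variable {n : ℕ} {Ω : Opens (Rn n)}

theorem enorm_Lp_two_sq {α : Type*} [MeasurableSpace α] {μ : Measure α} (u : Lp ℝ 2 μ) :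
    ‖u‖ₑ ^ 2 = ∫⁻ x, ‖u x‖ₑ ^ 2 ∂μ := by
  rw [Lp.enorm_def]
  simpa using eLpNorm_nnreal_pow_eq_lintegral (μ := μ) (f := u) (p := 2) two_ne_zero

theorem memLp_test (φ : 𝓓(Ω, ℝ)) : MemLp φ 2 (volume.restrict (Ω : Set (Rn n))) :=
  (φ.continuous.memLp_of_hasCompactSupport φ.hasCompactSupport).restrict _

theorem memLp_partialDeriv_test (φ : 𝓓(Ω, ℝ)) (i : Fin n) :
    MemLp (partialDeriv i φ) 2 (volume.restrict (Ω : Set (Rn n))) :=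
  ((partialDeriv_continuous (φ.contDiff.of_le (by simp)) i).memLp_of_hasCompactSupport
    (φ.hasCompactSupport.fderiv_apply ℝ _)).restrict _

/-- Integration by parts on the whole space, both integrands vanishing off `Ω`; it makes the
classical gradient of a test function its weak gradient. -/
theorem integral_test_mul_partialDeriv (φ ψ : 𝓓(Ω, ℝ)) (i : Fin n) :
    ∫ x in (Ω : Set (Rn n)), φ x * partialDeriv i ψ x =
      -∫ x in (Ω : Set (Rn n)), partialDeriv i φ x * ψ x := by
  have hc : ∀ χ : 𝓓(Ω, ℝ), Continuous (partialDeriv i χ) := fun χ =>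
    partialDeriv_continuous (χ.contDiff.of_le (by simp)) i
  have hd : ∀ χ : 𝓓(Ω, ℝ), Differentiable ℝ χ := fun χ => χ.contDiff.differentiable (by simp)
  have hs : ∀ χ : 𝓓(Ω, ℝ), HasCompactSupport (partialDeriv i χ) := fun χ =>
    χ.hasCompactSupport.fderiv_apply ℝ _
  rw [setIntegral_eq_integral_of_forall_compl_eq_zero, setIntegral_eq_integral_of_forall_compl_eq_zero]
  · exact integral_mul_fderiv_eq_neg_fderiv_mul_of_integrable
      (((hc φ).mul ψ.continuous).integrable_of_hasCompactSupport ψ.hasCompactSupport.mul_left)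
      ((φ.continuous.mul (hc ψ)).integrable_of_hasCompactSupport (hs ψ).mul_left)
      ((φ.continuous.mul ψ.continuous).integrable_of_hasCompactSupport
        ψ.hasCompactSupport.mul_left) (fun x _ => hd φ x) (fun x _ => hd ψ x)
  · intro x hx
    rw [test_eq_zero_of_notMem ψ hx, mul_zero]
  · intro x hx
    rw [test_eq_zero_of_notMem φ hx, zero_mul]

/-- A test function, as an element of `H¹(Ω)`. -/
def H1.ofTest (φ : 𝓓(Ω, ℝ)) : H1 Ω :=
  ⟨WithLp.toLp 2 ((memLp_test φ).toLp φ,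
    WithLp.toLp 2 fun i => (memLp_partialDeriv_test φ i).toLp (partialDeriv i φ)), by
    intro ψ i
    have h1 : (fun x => (memLp_test φ).toLp φ x * partialDeriv i ψ x)
        =ᵐ[volume.restrict (Ω : Set (Rn n))] fun x => φ x * partialDeriv i ψ x := by
      filter_upwards [(memLp_test φ).coeFn_toLp] with x hx
      rw [hx]
    have h2 : (fun x => (memLp_partialDeriv_test φ i).toLp (partialDeriv i φ) x * ψ x)
        =ᵐ[volume.restrict (Ω : Set (Rn n))] fun x => partialDeriv i φ x * ψ x := by
      filter_upwards [(memLp_partialDeriv_test φ i).coeFn_toLp] with x hx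
      rw [hx]
    exact (integral_congr_ae h1).trans
      ((integral_test_mul_partialDeriv φ ψ i).trans (congrArg Neg.neg (integral_congr_ae h2).symm))⟩

theorem H1.ofTest_mem (φ : 𝓓(Ω, ℝ)) : H1.ofTest φ ∈ testH1 Ω :=
  ⟨φ, (memLp_test φ).coeFn_toLp⟩

theorem exists_ofTest_eq {w : H1 Ω} (hw : w ∈ testH1 Ω) : ∃ φ, H1.ofTest φ = w := by
  obtain ⟨φ, hφ⟩ := hw
  exact ⟨φ, H1.ext (Lp.ext ((memLp_test φ).coeFn_toLp.trans hφ.symm))⟩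

theorem enorm_grad_ofTest_sq (φ : 𝓓(Ω, ℝ)) : ‖(H1.ofTest φ).1.snd‖ₑ ^ 2 = energy Ω φ := by
  have h : ∀ i, ‖(memLp_partialDeriv_test φ i).toLp (partialDeriv i φ)‖ₑ ^ 2 =
      ∫⁻ x in (Ω : Set (Rn n)), ‖partialDeriv i φ x‖ₑ ^ 2 := fun i => by
    rw [enorm_Lp_two_sq]
    refine lintegral_congr_ae ?_
    filter_upwards [(memLp_partialDeriv_test φ i).coeFn_toLp] with x hx
    rw [hx]
  rw [energy, ← ofReal_norm, ← ENNReal.ofReal_pow (norm_nonneg _), PiLp.norm_sq_eq_of_L2,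
    ENNReal.ofReal_sum_of_nonneg fun _ _ => sq_nonneg _]
  refine Finset.sum_congr rfl fun i _ => ?_
  rw [← h i, ENNReal.ofReal_pow (norm_nonneg _), ofReal_norm]
  rfl

theorem norm_le_of_enorm_sq_le {E F : Type*} [SeminormedAddGroup E] [SeminormedAddGroup F]
    {x : E} {y : F} {C : ℝ} (hC : 0 ≤ C) (h : ‖x‖ₑ ^ 2 ≤ ENNReal.ofReal C ^ 2 * ‖y‖ₑ ^ 2) :
    ‖x‖ ≤ C * ‖y‖ := by
  rw [← mul_pow, ← ofReal_norm, ← ofReal_norm, ← ENNReal.ofReal_mul hC] at h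
  have := (ENNReal.pow_le_pow_left_iff two_ne_zero).1 h
  exact (ENNReal.ofReal_le_ofReal_iff (by positivity)).1 this

/-- A closed homogeneous estimate holds on `H¹₀(Ω)` if it holds for test functions. -/
theorem H10.norm_le_of_test (A : L2 Ω →L[ℝ] L2 Ω) (C : ℝ)
    (h : ∀ φ : 𝓓(Ω, ℝ), ‖A (H1.ofTest φ).1.fst‖ ≤ C * ‖(H1.ofTest φ).1.snd‖) (ψ : H10 Ω) :
    ‖A ψ.toL2‖ ≤ C * ‖ψ‖ := by
  have hcl : IsClosed {w : H1 Ω | ‖A w.1.fst‖ ≤ C * ‖w.1.snd‖} := by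
    refine isClosed_le ?_ ?_
    · exact (A.continuous.comp ((WithLp.prod_continuous_ofLp 2 _ _).comp
        continuous_subtype_val).fst).norm
    · exact continuous_const.mul ((WithLp.prod_continuous_ofLp 2 _ _).comp
        continuous_subtype_val).snd.norm
  refine closure_minimal ?_ hcl ψ.2
  intro w hw
  obtain ⟨φ, rfl⟩ := exists_ofTest_eq hw
  exact h φ

theorem H10.exists_norm_toL2_le (hn : 0 < n) (hΩ : Bornology.IsBounded (Ω : Set (Rn n))) :
    ∃ C : ℝ, ∀ ψ : H10 Ω, ‖ψ.toL2‖ ≤ C * ‖ψ‖ := by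
  have : Nonempty (Fin n) := ⟨⟨0, hn⟩⟩
  obtain ⟨R, hR⟩ := Metric.isBounded_iff.1 hΩ
  have hR0 : 0 ≤ |R| + 1 := by positivity
  -- The `+ 1` makes the diameter bound strict, as `poincare_test` requires.
  refine ⟨|R| + 1, H10.norm_le_of_test (ContinuousLinearMap.id ℝ _) _ fun φ => ?_⟩
  refine norm_le_of_enorm_sq_le hR0 ?_
  rw [enorm_grad_ofTest_sq, enorm_Lp_two_sq]
  refine le_trans (le_of_eq (lintegral_congr_ae ?_)) (poincare_test (fun x hx y hy => ?_) hR0 φ)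
  · filter_upwards [(memLp_test φ).coeFn_toLp] with x hx
    exact congrArg (‖·‖ₑ ^ 2) hx
  · rw [← dist_eq_norm]
    linarith [hR hx hy, le_abs_self R]

theorem H10.exists_finiteDimensional_norm_sub_le (hn : 0 < n)
    (hΩ : Bornology.IsBounded (Ω : Set (Rn n))) {δ : ℝ} (hδ : 0 < δ) :
    ∃ (V : Submodule ℝ (L2 Ω)) (_ : FiniteDimensional ℝ V),
      ∀ ψ : H10 Ω, ‖ψ.toL2 - V.starProjection ψ.toL2‖ ≤ δ * ‖ψ‖ := by
  have : Nonempty (Fin n) := ⟨⟨0, hn⟩⟩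
  have : IsFiniteMeasure (volume.restrict (Ω : Set (Rn n))) :=
    ⟨by simpa using hΩ.measure_lt_top⟩
  -- Chosen so that `2 ^ n * (2ε)² ≤ (2 ^ n * 2ε)² = δ²`.
  set ε : ℝ := δ / (2 * 2 ^ n)
  have hε : 0 < ε := by positivity
  obtain ⟨N, κ, e, hκ, he⟩ := exists_measurable_fin_near hΩ hε
  obtain ⟨V, hV, hmem⟩ : ∃ (V : Submodule ℝ (L2 Ω)) (_ : FiniteDimensional ℝ V),
      ∀ c, fiberConstLp (volume.restrict (Ω : Set (Rn n))) hκ c ∈ V :=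
    ⟨_, inferInstance, LinearMap.mem_range_self _⟩
  refine ⟨V, hV, ?_⟩
  suffices h : ∀ φ : 𝓓(Ω, ℝ), ‖(H1.ofTest φ).1.fst - V.starProjection (H1.ofTest φ).1.fst‖ ≤
      δ * ‖(H1.ofTest φ).1.snd‖ by
    intro ψ
    have h' := H10.norm_le_of_test (ContinuousLinearMap.id ℝ _ - V.starProjection) δ
      (fun φ => by rw [sub_apply, ContinuousLinearMap.id_apply]; exact h φ) ψ
    rwa [sub_apply, ContinuousLinearMap.id_apply] at h'
  intro φ
  obtain ⟨t, ht⟩ := exists_lintegral_enorm_comp_add_sub_sq_le volume φ.continuous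
    (lintegral_translate_sub_test_sq_le φ) ((measurable_of_finite e).comp hκ)
    Ω.isOpen.measurableSet hε he
  -- The projection is the best approximation in `V`, so the shifted samples `φ (e k + t)` serve as
  -- competitor.
  refine (norm_sub_starProjection_le V _ (hmem fun k => φ (e k + t))).trans
    (norm_le_of_enorm_sq_le hδ.le ?_)
  rw [enorm_grad_ofTest_sq, enorm_Lp_two_sq]
  refine le_trans (le_of_eq (lintegral_congr_ae ?_)) (ht.trans ?_)
  · filter_upwards [(memLp_test φ).coeFn_toLp, Lp.coeFn_sub (H1.ofTest φ).1.fst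
      (fiberConstLp _ hκ fun k => φ (e k + t)),
      coeFn_fiberConstLp (volume.restrict (Ω : Set (Rn n))) hκ fun k => φ (e k + t)] with x h1 h2 h3
    rw [h2, Pi.sub_apply, ← enorm_neg, neg_sub, h3]
    exact congrArg (‖φ (e (κ x) + t) - ·‖ₑ ^ 2) h1
  · rw [← mul_assoc, ← ENNReal.ofReal_pow (by positivity), ← ENNReal.ofReal_pow hδ.le,
      ← ENNReal.ofReal_mul (by positivity)]
    gcongr
    have h2 : (1 : ℝ) ≤ 2 ^ n := one_le_pow₀ one_le_two
    have h3 : (2 * ε) * 2 ^ n = δ := by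
      simp only [ε]
      field_simp
    rw [finrank_euclideanSpace_fin, ← h3, mul_pow (2 * ε), mul_comm, sq ((2 : ℝ) ^ n)]
    exact mul_le_mul_of_nonneg_left (le_mul_of_one_le_left (by positivity) h2) (sq_nonneg _)

/-- The fundamental lemma of the calculus of variations; it yields injectivity of `T`. -/
theorem eq_zero_of_forall_integral_mul_test_eq_zero {v : L2 Ω}
    (h : ∀ φ : 𝓓(Ω, ℝ), ∫ x in (Ω : Set (Rn n)), v x * φ x = 0) : v = 0 := by
  have hz := Ω.isOpen.ae_eq_zero_of_integral_contDiff_smul_eq_zero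
    (locallyIntegrableOn_of_locallyIntegrable_restrict
      ((Lp.memLp v).locallyIntegrable (by norm_num))) (fun g hg hgc hgs => by
      let φ : 𝓓(Ω, ℝ) := ⟨g, hg, hgc, hgs⟩
      rw [← h φ, setIntegral_eq_integral_of_forall_compl_eq_zero]
      · exact integral_congr_ae (Filter.Eventually.of_forall fun x => mul_comm _ _)
      · intro x hx
        rw [test_eq_zero_of_notMem φ hx, mul_zero])
  refine Lp.ext ?_
  rw [Filter.EventuallyEq, ae_restrict_iff' Ω.isOpen.measurableSet]
  have h0 := (ae_restrict_iff' Ω.isOpen.measurableSet).1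
    (Lp.coeFn_zero ℝ 2 (volume.restrict (Ω : Set (Rn n))))
  filter_upwards [hz, h0] with x hx hx0 hxΩ
  rw [hx hxΩ, hx0 hxΩ, Pi.zero_apply]

end Sobolev

end Rellich
end

theorem mainTheorem10 {n : ℕ} (hn : 0 < n) (Ω : TopologicalSpace.Opens (Rellich.Rn n))
    (hΩ : Bornology.IsBounded (Ω : Set (Rellich.Rn n))) :
    ∃ T : Rellich.L2 Ω →L[ℝ] Rellich.Hminus1 Ω,
      (∀ (v : Rellich.L2 Ω) (ψ : Rellich.H10 Ω),
        T v ψ = ∫ x in (Ω : Set (Rellich.Rn n)), v x * ψ.toL2 x) ∧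
      Function.Injective T ∧
      IsCompactOperator T := by
  obtain ⟨C, hC⟩ := Rellich.H10.exists_norm_toL2_le hn hΩ
  let T : Rellich.L2 Ω →L[ℝ] Rellich.Hminus1 Ω :=
    -- Poincaré's constant `C` bounds the pairing in the gradient norm.
    LinearMap.mkContinuous₂ ((innerₗ (Rellich.L2 Ω)).compl₂ Rellich.H10.toL2) C fun v ψ =>
      calc _ ≤ ‖v‖ * ‖ψ.toL2‖ := norm_inner_le_norm _ _
        _ ≤ ‖v‖ * (C * ‖ψ‖) := by gcongr; exact hC ψ
        _ = _ := by ring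
  have hT : ∀ v ψ, T v ψ = inner ℝ v ψ.toL2 := fun _ _ => rfl
  have hT' : ∀ v ψ, T v ψ = ∫ x in (Ω : Set (Rellich.Rn n)), v x * ψ.toL2 x := fun v ψ => by
    rw [hT, L2.inner_def]
    exact integral_congr_ae (Filter.Eventually.of_forall fun x => mul_comm _ _)
  refine ⟨T, hT', ?_, Rellich.isCompactOperator_of_transpose _ T hT fun δ hδ =>
    Rellich.H10.exists_finiteDimensional_norm_sub_le hn hΩ hδ⟩
  refine (injective_iff_map_eq_zero T).2 fun v hv => ?_
  refine Rellich.eq_zero_of_forall_integral_mul_test_eq_zero fun φ => ?_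
  let ψ : Rellich.H10 Ω :=
    ⟨Rellich.H1.ofTest φ, subset_closure (Rellich.H1.ofTest_mem φ)⟩
  have h : T v ψ = 0 := by rw [hv]; rfl
  rw [← h, hT']
  refine integral_congr_ae ?_
  filter_upwards [(Rellich.memLp_test φ).coeFn_toLp] with x hx
  exact congrArg (v x * ·) hx.symm
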